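/- Let $n\ge 3$, let $\mathbb E\cong\mathbb R^{n-1}$ be the space of all diagonal real $(n-1)\times(n-1)$ matrices $\mathbf y=\mathrm{diag}(y_2,\dots,y_n)$, and let $\mathbf 1\in\mathbb E$ be the identity matrix. Consider the second-order autonomous ordinary differential equation $$\ddot{\mathbf y}-(\mathrm{tr}\,\mathbf y+\mathbf y)\,\dot{\mathbf y}=(\mathrm{tr}\,\mathbf y^2)\,\mathbf y-(\mathrm{tr}\,\mathbf y)\,\mathbf y^2\qquad(*)$$ for $C^2$ curves $I\ni t\mapsto\mathbf y(t)\in\mathbb E$ on open intervals $I\subseteq\mathbb R$, where products are matrix products and, in the sum $\mathrm{tr}\,\mathbf y+\mathbf y$, the symbol $\mathrm{tr}\,\mathbf y$ stands for $(\mathrm{tr}\,\mathbf y)\mathbf 1$. A solution is called maximal if it cannot be extended to a solution on a larger open interval. **Theorem.** For every $(\xi,\zeta)\in\mathbb R\times(0,\infty)$ there is a neighbourhood $U$ of $(\xi\mathbf 1,-\zeta\mathbf 1)$ in $\mathbb E\times\mathbb E$ such that every maximal solution $\mathbf y$ of $(*)$, with $0$ in its domain and $(\mathbf y(0),\dot{\mathbf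 y}(0))\in U$, has the following properties. 1. The domain of $\mathbf y$ is $\mathbb R$. 2. There exist smooth functions $g_{22},\dots,g_{nn}:\mathbb R\to(0,\infty)$ with $2y_j\,g_{jj}=-\dot g_{jj}$ for $j=2,\dots,n$ and, for every choice of such functions, the Riemannian metric $g$ on $\mathbb R^n$ whose component functions in the Cartesian coordinates $x^1,\dots,x^n$ are $$g_{11}=1,\qquad g_{jj}=g_{jj}(x^1)\ \text{ for } j\ge 2,\qquad g_{kl}=0\ \text{ for } k\ne l,$$ is complete. -/

import Mathlib

open Set Filter Topology
open scoped Manifold ContDiff Bundle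

namespace HarmonicCurvature

/-- The trace of the diagonal matrix with diagonal entries `y`. Diagonal `m × m` matrices are
represented by their diagonals `Fin m → ℝ`; the matrix product is the componentwise product and the
identity matrix is `1`. -/
def tr {m : ℕ} (y : Fin m → ℝ) : ℝ := ∑ j, y j

/-- `y` is a `C²` solution, on the open interval `I`, of
`ÿ - (tr y + y) ẏ = (tr y²) y - (tr y) y²`
(the values of `y` outside `I` are irrelevant). -/
structure IsSolution {m : ℕ} (I : Set ℝ) (y : ℝ → Fin m → ℝ) : Prop where
  isOpen : IsOpen I
  ordConnected : I.OrdConnected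
  nonempty : I.Nonempty
  contDiffOn : ContDiffOn ℝ 2 y I
  ode : ∀ t ∈ I, deriv (deriv y) t - (tr (y t) • (1 : Fin m → ℝ) + y t) * deriv y t
    = tr (y t ^ 2) • y t - tr (y t) • y t ^ 2

/-- A solution is maximal if it cannot be extended to a larger open interval. -/
structure IsMaximalSolution {m : ℕ} (I : Set ℝ) (y : ℝ → Fin m → ℝ) : Prop
    extends IsSolution I y where
  eq_of_extends : ∀ (J : Set ℝ) (z : ℝ → Fin m → ℝ),
    IsSolution J z → I ⊆ J → EqOn z y I → J = I

/-- A smooth curve `t ↦ (g₂₂(t), …, gₙₙ(t)) ∈ (0,∞)ⁿ⁻¹` with `n = m + 1`, defined on all of `ℝ`;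
the component `g_{j+2,j+2}` is `coeff j`. -/
structure MetricCurve (m : ℕ) where
  coeff : Fin m → ℝ → ℝ
  contDiff : ∀ j, ContDiff ℝ ∞ (coeff j)
  pos : ∀ j t, 0 < coeff j t

/-- The relation `2 y_j g_jj = -ġ_jj` between a metric curve and a curve `y`. -/
def MetricCurve.IsAssociated {m : ℕ} (c : MetricCurve m) (y : ℝ → Fin m → ℝ) : Prop :=
  ∀ (j : Fin m) (t : ℝ), 2 * y t j * c.coeff j t = -deriv (c.coeff j) t

/-- The bilinear form `v₁ w₁ + ∑ⱼ gⱼⱼ(t) vⱼ wⱼ` on `ℝⁿ`, `n = m + 1`. -/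
noncomputable def MetricCurve.form {m : ℕ} (c : MetricCurve m) (t : ℝ) :
    (Fin (m + 1) → ℝ) →L[ℝ] (Fin (m + 1) → ℝ) →L[ℝ] ℝ :=
  let e : Fin (m + 1) → (Fin (m + 1) → ℝ) →L[ℝ] ℝ := ContinuousLinearMap.proj
  (e 0).smulRight (e 0) + ∑ j : Fin m, c.coeff j t • (e j.succ).smulRight (e j.succ)

theorem MetricCurve.form_apply {m : ℕ} (c : MetricCurve m) (t : ℝ) (v w : Fin (m + 1) → ℝ) :
    c.form t v w = v 0 * w 0 + ∑ j : Fin m, c.coeff j t * (v j.succ * w j.succ) := by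
  simp [MetricCurve.form]

theorem MetricCurve.form_pos {m : ℕ} (c : MetricCurve m) (t : ℝ) (v : Fin (m + 1) → ℝ)
    (hv : v ≠ 0) : 0 < c.form t v v := by
  rw [c.form_apply]
  have h0 : ∀ j : Fin m, 0 ≤ c.coeff j t * (v j.succ * v j.succ) := fun j =>
    mul_nonneg (c.pos j t).le (mul_self_nonneg _)
  by_cases h : v 0 = 0
  · obtain ⟨k, hk⟩ := Function.ne_iff.mp hv
    have hk0 : k ≠ 0 := by
      rintro rfl
      exact hk h
    obtain ⟨j, rfl⟩ := Fin.exists_succ_eq.mpr hk0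
    have hj : 0 < c.coeff j t * (v j.succ * v j.succ) :=
      mul_pos (c.pos j t) (mul_self_pos.mpr hk)
    have := Finset.sum_pos' (s := Finset.univ) (fun j _ => h0 j) ⟨j, Finset.mem_univ j, hj⟩
    have := mul_self_nonneg (v 0)
    linarith
  · have := mul_self_pos.mpr h
    have := Finset.sum_nonneg (s := Finset.univ) (fun j _ => h0 j)
    linarith

theorem MetricCurve.form_isVonNBounded {m : ℕ} (c : MetricCurve m) (t : ℝ) :
    Bornology.IsVonNBounded ℝ {v : Fin (m + 1) → ℝ | c.form t v v < 1} := by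
  rw [NormedSpace.isVonNBounded_iff]
  have h0 : ∀ (v : Fin (m + 1) → ℝ) (j : Fin m), 0 ≤ c.coeff j t * (v j.succ * v j.succ) :=
    fun v j => mul_nonneg (c.pos j t).le (mul_self_nonneg _)
  refine (Metric.isBounded_closedBall (x := (0 : Fin (m + 1) → ℝ))
    (r := 1 + ∑ j, (1 + (c.coeff j t)⁻¹))).subset fun v hv => ?_
  have hinv : ∀ j : Fin m, 0 ≤ 1 + (c.coeff j t)⁻¹ := fun j =>
    add_nonneg zero_le_one (inv_nonneg.mpr (c.pos j t).le)
  have hS : 0 ≤ ∑ j, (1 + (c.coeff j t)⁻¹) := Finset.sum_nonneg fun j _ => hinv j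
  rw [mem_closedBall_zero_iff, pi_norm_le_iff_of_nonneg (by linarith)]
  have hv' : v 0 * v 0 + ∑ j : Fin m, c.coeff j t * (v j.succ * v j.succ) < 1 := by
    rw [← c.form_apply]
    exact hv
  intro k
  rw [Real.norm_eq_abs]
  refine Fin.cases ?_ (fun j => ?_) k
  · have := Finset.sum_nonneg (s := Finset.univ) (fun j _ => h0 v j)
    have : |v 0| ≤ 1 := abs_le_one_iff_mul_self_le_one.mpr (by linarith)
    linarith
  · have h1 := Finset.single_le_sum (s := Finset.univ) (fun j _ => h0 v j) (Finset.mem_univ j)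
    have h2 := mul_self_nonneg (v 0)
    have h3 : c.coeff j t * (v j.succ * v j.succ) ≤ 1 := by
      linarith
    have h4 : v j.succ * v j.succ ≤ (c.coeff j t)⁻¹ := by
      rw [inv_eq_one_div, le_div_iff₀ (c.pos j t)]
      linarith
    have h5 : |v j.succ| ≤ 1 + (c.coeff j t)⁻¹ := by
      have := abs_mul_abs_self (v j.succ)
      have := inv_pos.mpr (c.pos j t)
      nlinarith [sq_nonneg (|v j.succ| - 1)]
    have h6 := Finset.single_le_sum (s := Finset.univ) (fun j _ => hinv j) (Finset.mem_univ j)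
    linarith

theorem mem_baseSet_modelSpace {F : Type*} [NormedAddCommGroup F] [NormedSpace ℝ F] (x y : F) :
    y ∈ (trivializationAt F (TangentSpace 𝓘(ℝ, F)) x).baseSet := by
  rw [TangentBundle.trivializationAt_baseSet, chartAt_self_eq]
  trivial

theorem symm_modelSpace {F : Type*} [NormedAddCommGroup F] [NormedSpace ℝ F] (x y v : F) :
    (trivializationAt F (TangentSpace 𝓘(ℝ, F)) x).symm y v = v :=
  ((trivializationAt F (TangentSpace 𝓘(ℝ, F)) x).symmL_apply (R := ℝ)
    (mem_baseSet_modelSpace x y) v).symm.trans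
    (DFunLike.congr_fun (TangentBundle.symmL_model_space (𝕜 := ℝ) x y) v)

theorem trivialization_bilin_modelSpace {F : Type*} [NormedAddCommGroup F] [NormedSpace ℝ F]
    (x y : F) (B : TangentSpace 𝓘(ℝ, F) y →L[ℝ] TangentSpace 𝓘(ℝ, F) y →L[ℝ] ℝ) :
    (trivializationAt (F →L[ℝ] F →L[ℝ] ℝ)
      (fun b : F => TangentSpace 𝓘(ℝ, F) b →L[ℝ] TangentSpace 𝓘(ℝ, F) b →L[ℝ] ℝ) x ⟨y, B⟩).2
      = B := by
  apply ContinuousLinearMap.ext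
  intro v
  apply ContinuousLinearMap.ext
  intro w
  have := inCoordinates_apply_eq₂ (𝕜 := ℝ) (F₁ := F) (E₁ := TangentSpace 𝓘(ℝ, F)) (F₂ := F)
    (E₂ := TangentSpace 𝓘(ℝ, F)) (F₃ := ℝ) (E₃ := Bundle.Trivial F ℝ) (x₀ := x) (x := y) (ϕ := B)
    (v := v) (w := w) (mem_baseSet_modelSpace x y) (mem_baseSet_modelSpace x y) (by simp)
  rw [symm_modelSpace, symm_modelSpace] at this
  refine Eq.trans this ?_
  simp
  rfl

theorem contMDiff_bilin_modelSpace {F : Type*} [NormedAddCommGroup F] [NormedSpace ℝ F]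
    (B : F → F →L[ℝ] F →L[ℝ] ℝ) (h : ContDiff ℝ ∞ B) :
    ContMDiff 𝓘(ℝ, F) (𝓘(ℝ, F).prod 𝓘(ℝ, F →L[ℝ] F →L[ℝ] ℝ)) ∞
      (fun b : F => Bundle.TotalSpace.mk' (F →L[ℝ] F →L[ℝ] ℝ)
        (E := fun b : F => TangentSpace 𝓘(ℝ, F) b →L[ℝ] TangentSpace 𝓘(ℝ, F) b →L[ℝ] ℝ)
        b (B b)) := by
  intro x
  refine (Bundle.contMDiffAt_section _).mpr ?_
  exact ContMDiffAt.congr_of_eventuallyEq (f := B) h.contDiffAt.contMDiffAt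
    (Filter.Eventually.of_forall fun y => trivialization_bilin_modelSpace x y (B y))

theorem contDiff_smul_vec {V : Type*} [NormedAddCommGroup V] [NormedSpace ℝ V] {f : ℝ → ℝ}
    (hf : ContDiff ℝ ∞ f) (L : V) : ContDiff ℝ ∞ fun t => f t • L :=
  hf.smul contDiff_const

theorem MetricCurve.contDiff_form {m : ℕ} (c : MetricCurve m) : ContDiff ℝ ∞ c.form := by
  unfold MetricCurve.form
  refine contDiff_const.add (ContDiff.sum fun j _ => ?_)
  exact contDiff_smul_vec (c.contDiff j) _

/-- The Riemannian metric on `ℝⁿ`, `n = m + 1`, whose components in the Cartesian coordinates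
`x¹ = x 0, x², …, xⁿ` are `g₁₁ = 1`, `gⱼⱼ = gⱼⱼ(x¹)` for `j ≥ 2`, and `gₖₗ = 0` for `k ≠ l`. -/
noncomputable def MetricCurve.metric {m : ℕ} (c : MetricCurve m) :
    Bundle.ContMDiffRiemannianMetric 𝓘(ℝ, Fin (m + 1) → ℝ) ∞ (Fin (m + 1) → ℝ)
      (fun x : Fin (m + 1) → ℝ => TangentSpace 𝓘(ℝ, Fin (m + 1) → ℝ) x) where
  inner x := c.form (x 0)
  symm x v w := by
    refine (c.form_apply (x 0) v w).trans (Eq.trans ?_ (c.form_apply (x 0) w v).symm)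
    simp only [mul_comm]
  pos x v hv := c.form_pos (x 0) v hv
  isVonNBounded x := c.form_isVonNBounded (x 0)
  contMDiff := contMDiff_bilin_modelSpace (fun x => c.form (x 0))
    (c.contDiff_form.comp (contDiff_apply ℝ ℝ (0 : Fin (m + 1))))

/-- A smooth Riemannian metric on a manifold is complete if the manifold is a complete space for the
associated Riemannian distance (the infimum of the lengths of `C¹` curves). -/
def IsCompleteMetric {E : Type*} [NormedAddCommGroup E] [NormedSpace ℝ E]
    {H : Type*} [TopologicalSpace H] (I : ModelWithCorners ℝ E H)
    {M : Type*} [TopologicalSpace M] [T3Space M] [ChartedSpace H M] [IsManifold I 1 M]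
    (g : Bundle.ContMDiffRiemannianMetric I ∞ E (fun x : M => TangentSpace I x)) : Prop :=
  letI : Bundle.RiemannianBundle (fun x : M => TangentSpace I x) := ⟨g.toRiemannianMetric⟩
  haveI : IsContinuousRiemannianBundle E (fun x : M => TangentSpace I x) :=
    ⟨⟨g.inner, g.contMDiff.continuous, fun _ _ _ => rfl⟩⟩
  letI : EMetricSpace M := EMetricSpace.ofRiemannianMetric I M
  CompleteSpace M

end HarmonicCurvature

/-! Put h = tr y. Scalar matrices form an invariant set of (*), and the proof shows that nearby
solutions remain near it. The trace of (*) has zero right-hand side, so `scal` = 2 tr ẏ − tr y² − h²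
is a first integral. On scalar matrices tr y² = h²/m, hence h' = α h² + `scal`/2 with α =
(m+1)/(2m). At (ξ1, −ζ1) one has `scal` = −2αA₀² with A₀ > m|ξ|, which is where ζ > 0 enters. So h
starts in (−A₀, A₀) and decreases towards −A₀.

Transversally, d = y_i − y_j and f = ẏ_i − ẏ_j − (y_i² − y_j²)/2 satisfy d' = σd + f, f' = hf + κd
with σ ≈ h/m and κ ≈ 0. Their weighted square sum `spread` decays once h is near −A but may grow
before that: its rate is at most 2(h+A) − A/m (`pair_growth_le`). Since h' ≤ −β(h+A) + δ, the factor
exp(Lh) with Lβ = 2 cancels the term 2(h+A), and δ is small enough that `spread` · exp(Lh) does not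
increase. Thus h and `spread` are trapped (`trapping_region`, `IsSolution.mem_trapping_region`),
which bounds y and ẏ in the future.

The symmetry y(t) ↦ −y(−t) gives the same bound in the past, so a maximal solution is global. The
g_jj are then exponentials of integrals of y. A metric of this shape is complete: paths of bounded
length stay in a slab of bounded x¹, where the metric dominates a multiple of the Euclidean one. -/

namespace HarmonicCurvature

/-! ### Autonomous equations: continuation and smoothness -/

section Autonomous

variable {E : Type*} [NormedAddCommGroup E] [NormedSpace ℝ E]

/-- A bounded integral curve of a `C¹` vector field on a bounded interval extends to the right. -/
theorem exists_integralCurve_extension_right [ProperSpace E] {f : E → E} (hf : ContDiff ℝ 1 f)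
    {X : ℝ → E} {a b R : ℝ} (hab : a < b) (hX : ∀ t ∈ Ioo a b, HasDerivAt X (f (X t)) t)
    (hR : ∀ t ∈ Ioo a b, ‖X t‖ ≤ R) :
    ∃ ε > 0, ∃ Z : ℝ → E, (∀ t < b, Z t = X t) ∧
      ∀ t ∈ Ioo a (b + ε), HasDerivAt Z (f (Z t)) t := by
  obtain ⟨C, hC⟩ := (isCompact_closedBall (0 : E) R).exists_bound_of_continuousOn
    hf.continuous.continuousOn
  -- Bounded velocity makes X Lipschitz, so it has a limit x at b; a local solution through x at
  -- time b is then glued on.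
  have hlip : LipschitzOnWith C.toNNReal X (Ioo a b) :=
    (convex_Ioo a b).lipschitzOnWith_of_nnnorm_hasDerivWithin_le
      (fun t ht => (hX t ht).hasDerivWithinAt) fun t ht => by
        rw [← norm_toNNReal]
        exact Real.toNNReal_le_toNNReal (hC _ (mem_closedBall_zero_iff.mpr (hR t ht)))
  have hmem : Ioo a b ∈ 𝓝[<] b := Ioo_mem_nhdsLT hab
  obtain ⟨x, hx⟩ : ∃ x, Tendsto X (𝓝[<] b) (𝓝 x) :=
    CompleteSpace.complete ((cauchy_nhds.mono nhdsWithin_le_nhds).map_of_le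
      hlip.uniformContinuousOn (le_principal_iff.mpr hmem))
  obtain ⟨α, hα, ε, hε, hα'⟩ :=
    hf.contDiffAt.exists_forall_mem_closedBall_exists_eq_forall_mem_Ioo_hasDerivAt₀
      (x₀ := x) b
  classical
  refine ⟨ε, hε, fun t => if t < b then X t else α t, fun t ht => by simp [ht], fun t ht => ?_⟩
  set Z : ℝ → E := fun t => if t < b then X t else α t with hZ
  have hZX : ∀ t < b, Z t = X t := fun t ht => by simp [hZ, ht]
  have hZα : ∀ t, b ≤ t → Z t = α t := fun t ht => by simp [hZ, ht.not_gt]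
  have hleft : ∀ t ∈ Ioo a b, HasDerivAt Z (f (Z t)) t := fun t ht => by
    rw [hZX t ht.2]
    exact (hX t ht).congr_of_eventuallyEq ((eventually_lt_nhds ht.2).mono fun s hs => hZX s hs)
  rcases lt_trichotomy t b with h | h | h
  · exact hleft t ⟨ht.1, h⟩
  · subst h
    have hZt : Z t = x := (hZα t le_rfl).trans hα
    have hlim : Tendsto Z (𝓝[<] t) (𝓝 x) :=
      hx.congr' (eventually_nhdsWithin_of_forall fun s hs => (hZX s hs).symm)
    -- At the gluing point the left derivative is the limit of the derivatives f (Z s) as s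
    -- increases to b.
    have h1 : HasDerivWithinAt Z (f x) (Iic t) t := by
      refine hasDerivWithinAt_Iic_of_tendsto_deriv (s := Ioo a t)
        (fun s hs => (hleft s hs).differentiableAt.differentiableWithinAt) ?_ hmem ?_
      · rw [ContinuousWithinAt, hZt]
        exact hlim.mono_left (nhdsWithin_mono _ fun s hs => hs.2)
      · refine ((hf.continuous.tendsto x).comp hlim).congr' ?_
        filter_upwards [hmem] with s hs using (hleft s hs).deriv.symm
    have h2 : HasDerivWithinAt Z (f x) (Ici t) t := by
      have := hα' t ⟨by linarith, by linarith⟩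
      rw [hα] at this
      exact this.hasDerivWithinAt.congr (fun s hs => hZα s hs) (hZα t le_rfl)
    rw [hZt]
    simpa using h1.union h2
  · rw [hZα t h.le]
    exact (hα' t ⟨by linarith, ht.2⟩).congr_of_eventuallyEq
      ((eventually_gt_nhds h).mono fun s hs => hZα s (le_of_lt hs))

/-- Bootstrapping: if X is Cⁿ, so is X' = f ∘ X. -/
theorem contDiff_of_hasDerivAt_comp {f : E → E} (hf : ContDiff ℝ ∞ f) {X : ℝ → E}
    (hX : ∀ t, HasDerivAt X (f (X t)) t) : ContDiff ℝ ∞ X := by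
  refine contDiff_infty.mpr fun n => ?_
  induction n with
  | zero => exact contDiff_zero.mpr (continuous_iff_continuousAt.mpr fun t => (hX t).continuousAt)
  | succ n ih =>
    have hd : deriv X = f ∘ X := funext fun t => (hX t).deriv
    push_cast
    refine contDiff_succ_iff_deriv.mpr ⟨fun t => (hX t).differentiableAt, by simp, ?_⟩
    rw [hd]
    exact (contDiff_infty.mp hf n).comp ih

end Autonomous

/-! ### The first-order system and continuation of solutions of (*) -/

variable {m : ℕ}

/-- The vector field of the first-order system equivalent to the equation of `IsSolution`. -/
def field (p : (Fin m → ℝ) × (Fin m → ℝ)) : (Fin m → ℝ) × (Fin m → ℝ) :=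
  (p.2, (tr p.1 • (1 : Fin m → ℝ) + p.1) * p.2 + (tr (p.1 ^ 2) • p.1 - tr p.1 • p.1 ^ 2))

theorem contDiff_tr {n : WithTop ℕ∞} : ContDiff ℝ n (tr : (Fin m → ℝ) → ℝ) :=
  ContDiff.sum fun j _ => contDiff_apply ℝ ℝ j

theorem contDiff_field {n : WithTop ℕ∞} : ContDiff ℝ n (field (m := m)) := by
  have h1 : ContDiff ℝ n fun p : (Fin m → ℝ) × (Fin m → ℝ) => tr p.1 :=
    contDiff_tr.comp contDiff_fst
  have h2 : ContDiff ℝ n fun p : (Fin m → ℝ) × (Fin m → ℝ) => tr (p.1 ^ 2) :=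
    contDiff_tr.comp (contDiff_fst.pow 2)
  exact contDiff_snd.prodMk ((((h1.smul contDiff_const).add contDiff_fst).mul contDiff_snd).add
    ((h2.smul contDiff_fst).sub (h1.smul (contDiff_fst.pow 2))))

theorem IsSolution.hasDerivAt {I : Set ℝ} {y : ℝ → Fin m → ℝ} (h : IsSolution I y) {t : ℝ}
    (ht : t ∈ I) :
    HasDerivAt (fun t => (y t, deriv y t)) (field (y t, deriv y t)) t := by
  have hI : I ∈ 𝓝 t := h.isOpen.mem_nhds ht
  have h1 : HasDerivAt y (deriv y t) t :=
    ((h.contDiffOn.differentiableOn (by norm_num)).differentiableAt hI).hasDerivAt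
  have h2 : ContDiffOn ℝ 1 (deriv y) I :=
    ((contDiffOn_succ_iff_deriv_of_isOpen (n := 1) h.isOpen).mp
      (by simpa [one_add_one_eq_two] using h.contDiffOn)).2.2
  have h3 : HasDerivAt (deriv y) (deriv (deriv y) t) t :=
    ((h2.differentiableOn (by norm_num)).differentiableAt hI).hasDerivAt
  rw [sub_eq_iff_eq_add'.mp (h.ode t ht)] at h3
  exact h1.prodMk h3

theorem isSolution_of_hasDerivAt {I : Set ℝ} {X : ℝ → (Fin m → ℝ) × (Fin m → ℝ)}
    (ho : IsOpen I) (hc : I.OrdConnected) (hne : I.Nonempty)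
    (h : ∀ t ∈ I, HasDerivAt X (field (X t)) t) : IsSolution I fun t => (X t).1 := by
  have h1 : ∀ t ∈ I, HasDerivAt (fun t => (X t).1) (X t).2 t := fun t ht =>
    (hasFDerivAt_fst.comp_hasDerivAt t (h t ht) :)
  have h2 : ∀ t ∈ I, HasDerivAt (fun t => (X t).2) (field (X t)).2 t := fun t ht =>
    (hasFDerivAt_snd.comp_hasDerivAt t (h t ht) :)
  have e1 : EqOn (deriv fun t => (X t).1) (fun t => (X t).2) I := fun t ht => (h1 t ht).deriv
  have e2 : EqOn (deriv (deriv fun t => (X t).1)) (fun t => (field (X t)).2) I := fun t ht =>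
    ((e1.eventuallyEq_of_mem (ho.mem_nhds ht)).deriv_eq).trans (h2 t ht).deriv
  have hX : ContinuousOn X I := fun t ht => (h t ht).continuousAt.continuousWithinAt
  refine ⟨ho, hc, hne, ?_, fun t ht => ?_⟩
  · have hd : ContDiffOn ℝ 1 (fun t => (X t).2) I := by
      rw [show (1 : WithTop ℕ∞) = 0 + 1 by simp, contDiffOn_succ_iff_deriv_of_isOpen ho]
      refine ⟨fun t ht => (h2 t ht).differentiableAt.differentiableWithinAt, by simp, ?_⟩
      refine contDiffOn_zero.mpr (ContinuousOn.congr ?_ fun t ht => (h2 t ht).deriv)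
      exact (contDiff_field (n := 0)).continuous.snd.comp_continuousOn hX
    rw [← one_add_one_eq_two, contDiffOn_succ_iff_deriv_of_isOpen ho]
    exact ⟨fun t ht => (h1 t ht).differentiableAt.differentiableWithinAt, by simp, hd.congr e1⟩
  · rw [e2 ht, e1 ht]
    simp [field]

theorem IsSolution.contDiff {y : ℝ → Fin m → ℝ} (h : IsSolution univ y) : ContDiff ℝ ∞ y :=
  contDiff_fst.comp (contDiff_of_hasDerivAt_comp contDiff_field fun _ => h.hasDerivAt (mem_univ _))

theorem IsSolution.exists_extension_right {I : Set ℝ} {y : ℝ → Fin m → ℝ} (h : IsSolution I y)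
    {a R : ℝ} (ha : a ∈ I) (hI : BddAbove I) (hR : ∀ t ∈ I, a ≤ t → ‖(y t, deriv y t)‖ ≤ R) :
    ∃ J z, IsSolution J z ∧ I ⊆ J ∧ EqOn z y I ∧ ¬ J ⊆ I := by
  set b := sSup I with hb
  have hlt : ∀ t ∈ I, t < b := fun t ht => by
    obtain ⟨u, hu, hIu⟩ := (mem_nhdsGE_iff_exists_Ico_subset (a := t)).mp
      (mem_nhdsWithin_of_mem_nhds (h.isOpen.mem_nhds ht))
    have hu' : t < u := hu
    exact lt_of_lt_of_le (by linarith : t < (t + u) / 2)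
      (le_csSup hI (hIu ⟨by linarith, by linarith⟩))
  have hIoo : Ioo a b ⊆ I := fun t ht => by
    obtain ⟨u, hu, htu⟩ := exists_lt_of_lt_csSup h.nonempty ht.2
    exact h.ordConnected.out ha hu ⟨ht.1.le, htu.le⟩
  obtain ⟨ε, hε, Z, hZ, hZ'⟩ := exists_integralCurve_extension_right contDiff_field (hlt a ha)
    (fun t ht => h.hasDerivAt (hIoo ht)) (fun t ht => hR t (hIoo ht) ht.1.le)
  refine ⟨I ∪ Ioo a (b + ε), fun t => (Z t).1, ?_, subset_union_left,
    fun t ht => by simp [hZ t (hlt t ht)], fun hsub => ?_⟩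
  · refine isSolution_of_hasDerivAt (h.isOpen.union isOpen_Ioo) ?_ ⟨a, Or.inl ha⟩ ?_
    · have hab := hlt a ha
      obtain ⟨u, hu, hIu⟩ := (mem_nhdsGE_iff_exists_Ico_subset (a := a)).mp
        (mem_nhdsWithin_of_mem_nhds (h.isOpen.mem_nhds ha))
      have hu' : a < u := hu
      have hw : (a + u) / 2 ∈ I := hIu ⟨by linarith, by linarith⟩
      exact (IsPreconnected.union ((a + u) / 2) hw
        (show (a + u) / 2 ∈ Ioo a (b + ε) from ⟨by linarith, by linarith [hlt _ hw]⟩)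
        h.ordConnected.isPreconnected isPreconnected_Ioo).ordConnected
    · rintro t (ht | ht)
      · rw [hZ t (hlt t ht)]
        exact (h.hasDerivAt ht).congr_of_eventuallyEq
          ((eventually_lt_nhds (hlt t ht)).mono fun s hs => hZ s hs)
      · exact hZ' t ht
  · exact lt_irrefl b (hlt b (hsub (Or.inr ⟨hlt a ha, by linarith⟩)))

theorem deriv_neg_comp_neg (y : ℝ → Fin m → ℝ) :
    (deriv fun t => -y (-t)) = fun t => deriv y (-t) := by
  funext t
  rw [deriv.fun_neg, deriv_comp_neg, neg_neg]

/-- The substitution leaves ẏ unchanged and flips y and ÿ, so every term of (*) changes sign. It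
reduces statements about the past to statements about the future. -/
theorem IsSolution.comp_neg {I : Set ℝ} {y : ℝ → Fin m → ℝ} (h : IsSolution I y) :
    IsSolution (Neg.neg ⁻¹' I) fun t => -y (-t) := by
  have hd := deriv_neg_comp_neg y
  refine ⟨h.isOpen.preimage continuous_neg, ?_, ?_, ?_, fun t ht => ?_⟩
  · exact ⟨fun s hs t ht u hu => h.ordConnected.out ht hs ⟨neg_le_neg hu.2, neg_le_neg hu.1⟩⟩
  · obtain ⟨t, ht⟩ := h.nonempty
    exact ⟨-t, by simpa using ht⟩
  · exact (h.contDiffOn.comp contDiff_neg.contDiffOn fun t ht => ht).neg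
  · rw [hd, deriv_comp_neg]
    have ho := h.ode (-t) ht
    funext j
    have := congrFun ho j
    simp only [tr, Pi.sub_apply, Pi.add_apply, Pi.mul_apply, Pi.smul_apply, Pi.neg_apply,
      Pi.pow_apply, Pi.one_apply, smul_eq_mul, mul_one, Finset.sum_neg_distrib, neg_sq] at this ⊢
    linear_combination -this

theorem IsMaximalSolution.eq_univ {I : Set ℝ} {y : ℝ → Fin m → ℝ} (h : IsMaximalSolution I y)
    {a R : ℝ} (ha : a ∈ I) (hr : ∀ t ∈ I, a ≤ t → ‖(y t, deriv y t)‖ ≤ R)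
    (hl : ∀ t ∈ I, t ≤ a → ‖(y t, deriv y t)‖ ≤ R) : I = univ := by
  have habove : ¬ BddAbove I := fun hb => by
    obtain ⟨J, z, hz, hIJ, he, hJ⟩ := h.toIsSolution.exists_extension_right ha hb hr
    exact hJ (h.eq_of_extends J z hz hIJ he).subset
  have hbelow : ¬ BddBelow I := fun hb => by
    have hd := deriv_neg_comp_neg y
    obtain ⟨J, z, hz, hIJ, he, hJ⟩ := h.toIsSolution.comp_neg.exists_extension_right
      (a := -a) (R := R) (by simpa using ha)
      (by
        obtain ⟨c, hc⟩ := hb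
        exact ⟨-c, fun t ht => le_neg.mp (hc ht)⟩)
      (fun t ht hat => by
        have := hl (-t) ht (neg_le.mp hat)
        rw [hd]
        simpa [Prod.norm_def] using this)
    have hsub : I ⊆ Neg.neg ⁻¹' J := fun t ht => hIJ (by simpa using ht)
    have := h.eq_of_extends _ _ hz.comp_neg hsub fun t ht => by
      simpa using congrArg Neg.neg (he (x := -t) (by simpa using ht))
    exact hJ fun t ht => this.subset (by simpa using ht)
  refine eq_univ_of_forall fun t => ?_
  obtain ⟨u, hu, htu⟩ := not_bddAbove_iff.mp habove t
  obtain ⟨s, hs, hst⟩ := not_bddBelow_iff.mp hbelow t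
  exact h.ordConnected.out hs hu ⟨hst.le, htu.le⟩

/-! ### Completeness of the metric -/

section Completeness

open MeasureTheory Manifold
open scoped ENNReal NNReal

/-- If a linear map is bounded by `C` along a path, for the Riemannian norm on the source, then it
increases the length of the path at most by the factor `C`. -/
theorem enorm_sub_le_mul_pathELength {F G : Type*} [NormedAddCommGroup F] [NormedSpace ℝ F]
    [NormedAddCommGroup G] [NormedSpace ℝ G]
    [Bundle.RiemannianBundle fun x : F => TangentSpace 𝓘(ℝ, F) x]
    {γ : ℝ → F} {a b : ℝ} (hab : a ≤ b) (hγ : ContDiffOn ℝ 1 γ (Icc a b)) (L : F →L[ℝ] G)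
    {C : ℝ≥0}
    (hL : ∀ t ∈ Icc a b, ∀ v : TangentSpace 𝓘(ℝ, F) (γ t), ‖L v‖ₑ ≤ C * ‖v‖ₑ) :
    ‖L (γ b) - L (γ a)‖ₑ ≤ C * pathELength 𝓘(ℝ, F) γ a b := by
  rcases hab.eq_or_lt with rfl | hlt
  · simp
  rw [pathELength_eq_lintegral_mfderivWithin_Icc, ← lintegral_const_mul' _ _ ENNReal.coe_ne_top]
  refine (enorm_sub_le_lintegral_derivWithin_Icc_of_contDiffOn_Icc
    (L.contDiff.comp_contDiffOn hγ) hab).trans ?_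
  refine setLIntegral_mono' measurableSet_Icc fun t ht => ?_
  have hd := (hγ.differentiableOn (by norm_num) t ht).hasFDerivWithinAt
  have : derivWithin (fun t => L (γ t)) (Icc a b) t = L (fderivWithin ℝ γ (Icc a b) t 1) :=
    ((L.hasFDerivAt.comp_hasFDerivWithinAt t hd).hasDerivWithinAt.derivWithin
      (uniqueDiffOn_Icc hlt t ht) :)
  rw [mfderivWithin_eq_fderivWithin]
  exact (congrArg enorm this).le.trans (hL t ht _)

/-- A Cauchy sequence eventually lies in a unit ball about one of its terms p; there the hypothesis
makes it norm-Cauchy, and its norm limit serves because the topologies agree. Since C may depend on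
p, a merely local comparison with the norm suffices. -/
theorem completeSpace_of_edist_le {F : Type*} [NormedAddCommGroup F] [CompleteSpace F]
    (e : PseudoEMetricSpace F)
    (htop : e.toUniformSpace.toTopologicalSpace = PseudoMetricSpace.toUniformSpace.toTopologicalSpace)
    (h : ∀ p, ∃ C : ℝ≥0, ∀ x y, e.edist x p < 1 → e.edist x y < 1 →
      ‖y - x‖ₑ ≤ C * e.edist x y) :
    @CompleteSpace F e.toUniformSpace := by
  refine @EMetric.complete_of_cauchySeq_tendsto F e fun (u : ℕ → F) hu => ?_
  have hc := (@EMetric.cauchySeq_iff F ℕ e _ _ u).mp hu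
  obtain ⟨N, hN⟩ := hc 1 one_pos
  obtain ⟨C, hC⟩ := h (u N)
  have hu' : CauchySeq u := by
    refine (@EMetric.cauchySeq_iff F ℕ PseudoMetricSpace.toPseudoEMetricSpace _ _ u).mpr
      fun ε hε => ?_
    have hδ : 0 < min 1 (ε / (C + 1)) :=
      lt_min one_pos (ENNReal.div_pos hε.ne' (by simp))
    obtain ⟨N', hN'⟩ := hc _ hδ
    refine ⟨max N N', fun i hi j hj => ?_⟩
    have h1 := hN' i (le_trans (le_max_right _ _) hi) j (le_trans (le_max_right _ _) hj)
    have h2 := hC (u i) (u j) (hN i (le_trans (le_max_left _ _) hi) N le_rfl)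
      (h1.trans_le (min_le_left _ _))
    have h3 := h1.trans_le (min_le_right _ _)
    refine ((@edist_comm F PseudoMetricSpace.toPseudoEMetricSpace _ _).trans (edist_eq_enorm_sub _ _)).trans_lt ?_
    refine h2.trans_lt (lt_of_le_of_lt ?_ ((ENNReal.lt_div_iff_mul_lt (by simp) (by simp)).mp h3))
    rw [mul_comm]
    gcongr
    exact le_self_add
  obtain ⟨x, hx⟩ := cauchySeq_tendsto_of_complete hu'
  refine ⟨x, ?_⟩
  rw [htop]
  exact hx

theorem MetricCurve.sq_zero_le_form (c : MetricCurve m) (t : ℝ) (v : Fin (m + 1) → ℝ) :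
    v 0 ^ 2 ≤ c.form t v v := by
  have := Finset.sum_nonneg fun j (_ : j ∈ Finset.univ) =>
    mul_nonneg (c.pos j t).le (mul_self_nonneg (v (Fin.succ j)))
  rw [c.form_apply]
  linarith [sq (v 0)]

/-- By compactness the 1/g_jj are bounded by |B| on [a, b]; C = 1 + |B| works because C² dominates
both 1 (for the x¹ component) and |B|. -/
theorem MetricCurve.exists_norm_sq_le_form (c : MetricCurve m) (a b : ℝ) :
    ∃ C : ℝ≥0, 0 < C ∧ ∀ t ∈ Icc a b, ∀ v, ‖v‖ ^ 2 ≤ (C : ℝ) ^ 2 * c.form t v v := by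
  obtain ⟨B, hB⟩ := (isCompact_Icc (a := a) (b := b)).exists_bound_of_continuousOn
    (f := fun t => ∑ j, (c.coeff j t)⁻¹)
    (continuous_finsetSum _ fun j _ => (c.contDiff j).continuous.inv₀
      fun t => (c.pos j t).ne').continuousOn
  refine ⟨⟨1 + |B|, by positivity⟩, ?_, fun t ht v => ?_⟩
  · exact_mod_cast (by positivity : 0 < 1 + |B|)
  have hf := c.form_apply t v v
  have hnn : ∀ j ∈ Finset.univ, 0 ≤ c.coeff j t * (v (Fin.succ j) * v (Fin.succ j)) :=
    fun j _ => mul_nonneg (c.pos j t).le (mul_self_nonneg _)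
  have hf0 : 0 ≤ c.form t v v := (sq_nonneg _).trans (c.sq_zero_le_form t v)
  have hle : ∀ k, ‖v k‖ ^ 2 ≤ (1 + |B|) ^ 2 * c.form t v v := by
    have hB2 : 1 + |B| ≤ (1 + |B|) ^ 2 := by nlinarith [abs_nonneg B]
    intro k
    rw [Real.norm_eq_abs, sq_abs]
    refine Fin.cases ?_ (fun j => ?_) k
    · nlinarith [c.sq_zero_le_form t v, abs_nonneg B]
    · have h1 : (c.coeff j t)⁻¹ ≤ |B| :=
        ((Finset.single_le_sum (f := fun j => (c.coeff j t)⁻¹)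
          (fun j _ => (inv_pos.mpr (c.pos j t)).le) (Finset.mem_univ j)).trans
          (le_abs_self _)).trans ((hB t ht).trans (le_abs_self B))
      have h2 : c.coeff j t * (v j.succ * v j.succ) ≤ c.form t v v := by
        have := Finset.single_le_sum hnn (Finset.mem_univ j)
        nlinarith [mul_self_nonneg (v 0)]
      calc v j.succ ^ 2 = (c.coeff j t)⁻¹ * (c.coeff j t * (v j.succ * v j.succ)) := by
            field_simp [(c.pos j t).ne']
        _ ≤ |B| * c.form t v v := by
            have := mul_nonneg (c.pos j t).le (mul_self_nonneg (v j.succ))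
            gcongr
        _ ≤ (1 + |B|) ^ 2 * c.form t v v := by gcongr; linarith
  have hs : ‖v‖ ≤ √((1 + |B|) ^ 2 * c.form t v v) :=
    (pi_norm_le_iff_of_nonneg (Real.sqrt_nonneg _)).mpr fun k => Real.le_sqrt_of_sq_le (hle k)
  exact (Real.le_sqrt (norm_nonneg v) (by positivity)).mp hs

theorem MetricCurve.isCompleteMetric (c : MetricCurve m) :
    IsCompleteMetric 𝓘(ℝ, Fin (m + 1) → ℝ) c.metric := by
  unfold IsCompleteMetric
  let _ : Bundle.RiemannianBundle
      (fun x : Fin (m + 1) → ℝ => TangentSpace 𝓘(ℝ, Fin (m + 1) → ℝ) x) :=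
    ⟨c.metric.toRiemannianMetric⟩
  have : IsContinuousRiemannianBundle (Fin (m + 1) → ℝ)
      (fun x : Fin (m + 1) → ℝ => TangentSpace 𝓘(ℝ, Fin (m + 1) → ℝ) x) :=
    ⟨⟨c.metric.inner, c.metric.contMDiff.continuous, fun _ _ _ => rfl⟩⟩
  have hnorm : ∀ (x : Fin (m + 1) → ℝ) (v : TangentSpace 𝓘(ℝ, Fin (m + 1) → ℝ) x),
      c.form (x 0) v v = ‖v‖ ^ 2 := fun x v => real_inner_self_eq_norm_sq v
  have henorm : ∀ {G : Type} [NormedAddCommGroup G] [NormedSpace ℝ G]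
      (L : (Fin (m + 1) → ℝ) →L[ℝ] G) (C : ℝ≥0) (x : Fin (m + 1) → ℝ)
      (v : TangentSpace 𝓘(ℝ, Fin (m + 1) → ℝ) x),
      ‖L v‖ ^ 2 ≤ (C : ℝ) ^ 2 * c.form (x 0) v v → ‖L v‖ₑ ≤ C * ‖v‖ₑ := by
    intro G _ _ L C x v h
    rw [hnorm, ← mul_pow] at h
    have h' : ‖L v‖ ≤ C * ‖v‖ := le_of_sq_le_sq h (by positivity)
    calc ‖L v‖ₑ = ENNReal.ofReal ‖L v‖ := (ofReal_norm (L v)).symm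
      _ ≤ ENNReal.ofReal (C * ‖v‖) := ENNReal.ofReal_le_ofReal h'
      _ = ENNReal.ofReal C * ENNReal.ofReal ‖v‖ := ENNReal.ofReal_mul C.2
      _ = C * ‖v‖ₑ := by rw [ofReal_norm v, ENNReal.ofReal_coe_nnreal]
  refine completeSpace_of_edist_le
    (PseudoEMetricSpace.ofRiemannianMetric 𝓘(ℝ, Fin (m + 1) → ℝ) (Fin (m + 1) → ℝ)) rfl fun p => ?_
  -- Half-width 2: x¹ changes by less than 1 from x to p, and again by less than 1 along a short
  -- path starting at x.
  obtain ⟨C, hC0, hC⟩ := c.exists_norm_sq_le_form (p 0 - 2) (p 0 + 2)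
  have hzero : ∀ (γ : ℝ → Fin (m + 1) → ℝ), ContDiffOn ℝ 1 γ (Icc 0 1) →
      pathELength 𝓘(ℝ, Fin (m + 1) → ℝ) γ 0 1 < 1 → ∀ t ∈ Icc (0 : ℝ) 1,
        |γ t 0 - γ 0 0| < 1 := by
    intro γ hγ hlen t ht
    have := enorm_sub_le_mul_pathELength ht.1 (hγ.mono (Icc_subset_Icc_right ht.2))
      (ContinuousLinearMap.proj (R := ℝ) (φ := fun _ : Fin (m + 1) => ℝ) 0) (C := 1)
      fun s _ v => henorm _ 1 _ v (by
        have := c.sq_zero_le_form (γ s 0) v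
        rw [NNReal.coe_one, one_pow, one_mul, Real.norm_eq_abs, sq_abs]
        exact this)
    rw [ENNReal.coe_one, one_mul] at this
    have := (this.trans (pathELength_mono le_rfl ht.2)).trans_lt hlen
    rwa [← ofReal_norm, ENNReal.ofReal_lt_one] at this
  have hpath : ∀ {x y : Fin (m + 1) → ℝ} {r : ℝ≥0∞},
      riemannianEDist 𝓘(ℝ, Fin (m + 1) → ℝ) x y < r → ∃ γ : ℝ → Fin (m + 1) → ℝ,
        γ 0 = x ∧ γ 1 = y ∧ ContDiffOn ℝ 1 γ (Icc 0 1) ∧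
          pathELength 𝓘(ℝ, Fin (m + 1) → ℝ) γ 0 1 < r := fun h => by
    obtain ⟨γ, h0, h1, hγ, hlen⟩ := exists_lt_of_riemannianEDist_lt h
    exact ⟨γ, h0, h1, hγ.contDiffOn, hlen⟩
  refine ⟨C, fun x y hxp hxy => ?_⟩
  change riemannianEDist 𝓘(ℝ, Fin (m + 1) → ℝ) x p < 1 at hxp
  change riemannianEDist 𝓘(ℝ, Fin (m + 1) → ℝ) x y < 1 at hxy
  change _ ≤ C * riemannianEDist 𝓘(ℝ, Fin (m + 1) → ℝ) x y
  obtain ⟨σ, rfl, rfl, hσ, hσ'⟩ := hpath hxp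
  have hd := hzero σ hσ hσ' 1 (by simp)
  by_contra! hlt
  -- If the estimate failed, some path would have length below both 1 and ‖y − x‖/C. It stays in the
  -- slab, where its length is at least ‖y − x‖/C.
  obtain ⟨γ, h0, rfl, hγ, hγ'⟩ := hpath (lt_min hxy (ENNReal.lt_div_iff_mul_lt
    (Or.inl (ENNReal.coe_ne_zero.mpr hC0.ne')) (Or.inl ENNReal.coe_ne_top)
    |>.mpr (by rwa [mul_comm])))
  have hslab := hzero γ hγ (hγ'.trans_le (min_le_left _ _))
  refine (ENNReal.mul_lt_of_lt_div' (hγ'.trans_le (min_le_right _ _))).not_ge ?_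
  rw [← h0]
  refine enorm_sub_le_mul_pathELength zero_le_one hγ (ContinuousLinearMap.id ℝ _)
    fun t ht v => henorm _ C _ v (hC (γ t 0) ?_ v)
  have := abs_lt.mp (hslab t ht)
  rw [h0] at this
  rw [abs_lt] at hd
  constructor <;> linarith

end Completeness

/-! ### Existence of the functions g_jj -/

theorem MetricCurve.exists_isAssociated {y : ℝ → Fin m → ℝ} (hy : ContDiff ℝ ∞ y) :
    ∃ c : MetricCurve m, c.IsAssociated y := by
  have hyj : ∀ j, ContDiff ℝ ∞ fun t => y t j := fun j => contDiff_pi.mp hy j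
  have hF : ∀ j t, HasDerivAt (fun t => ∫ s in (0 : ℝ)..t, y s j) (y t j) t := fun j t =>
    (hyj j).continuous.integral_hasStrictDerivAt 0 t |>.hasDerivAt
  have hFs : ∀ j, ContDiff ℝ ∞ fun t => ∫ s in (0 : ℝ)..t, y s j := fun j =>
    contDiff_infty_iff_deriv.mpr ⟨fun t => (hF j t).differentiableAt, by
      rw [funext fun t => (hF j t).deriv]
      exact hyj j⟩
  refine ⟨⟨fun j t => Real.exp (-2 * ∫ s in (0 : ℝ)..t, y s j),
    fun j => (contDiff_const.mul (hFs j)).exp, fun j t => Real.exp_pos _⟩, fun j t => ?_⟩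
  have := (((hF j t).const_mul (-2)).exp).deriv
  simp only
  rw [this]
  ring

/-! ### The abstract trapping argument -/

theorem deriv_nonpos_of_forall_lt {h : ℝ → ℝ} {h' a τ : ℝ} (haτ : a < τ)
    (hd : HasDerivAt h h' τ) (hlt : ∀ t ∈ Ico a τ, h τ ≤ h t) : h' ≤ 0 := by
  have := hasDerivWithinAt_iff_tendsto_slope' (show τ ∉ Iio τ by simp) |>.mp (hd.hasDerivWithinAt (s := Iio τ))
  refine le_of_tendsto this ?_
  filter_upwards [Ico_mem_nhdsLT haτ] with t ht
  rw [slope_def_field]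
  exact div_nonpos_of_nonneg_of_nonpos (sub_nonneg.mpr (hlt t ht)) (sub_nonpos.mpr ht.2.le)

/-- A trapping region for a pair of functions: `w * exp (L * h)` is a Lyapunov function as long as
`-A ≤ h ≤ H` and `w ≤ η`, and the walls `h = -A` and `h = H` repel. -/
theorem trapping_region {h w h' w' : ℝ → ℝ} {T A H L η : ℝ} (hT : 0 ≤ T) (hL : 0 ≤ L)
    (hh : ∀ t ∈ Icc 0 T, HasDerivAt h (h' t) t) (hw : ∀ t ∈ Icc 0 T, HasDerivAt w (w' t) t)
    (hlyap : ∀ t ∈ Icc 0 T, -A ≤ h t → h t ≤ H → w t ≤ η → w' t + L * h' t * w t ≤ 0)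
    (hlow : ∀ t ∈ Icc 0 T, h t = -A → w t ≤ η → 0 < h' t)
    (hupp : ∀ t ∈ Icc 0 T, h t = H → w t ≤ η → h' t < 0)
    (h0 : h 0 ∈ Ioo (-A) H) (hw0 : 0 ≤ w 0) (hw0' : w 0 * Real.exp (L * (H + A)) < η) :
    h T ∈ Ioo (-A) H ∧ w T < η := by
  by_contra hbad
  have hhc : ContinuousOn h (Icc 0 T) := fun t ht => (hh t ht).continuousAt.continuousWithinAt
  have hwc : ContinuousOn w (Icc 0 T) := fun t ht => (hw t ht).continuousAt.continuousWithinAt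
  -- S is the closed set of times outside the open region; its infimum τ is the first exit time, so
  -- all bounds are strict before τ and weak at τ.
  set S : Set ℝ := Icc 0 T ∩ (fun t => (h t, w t)) ⁻¹' (Ioo (-A) H ×ˢ Iio η)ᶜ with hS
  have hScl : IsClosed S := (hhc.prodMk hwc).preimage_isClosed_of_isClosed isClosed_Icc
    (isOpen_Ioo.prod isOpen_Iio).isClosed_compl
  have hSne : S.Nonempty := ⟨T, ⟨hT, le_rfl⟩, fun hmem => hbad ⟨hmem.1, hmem.2⟩⟩
  have hSbdd : BddBelow S := ⟨0, fun t ht => ht.1.1⟩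
  obtain ⟨hτI, hτbad⟩ := hScl.csInf_mem hSne hSbdd
  set τ := sInf S with hτ
  have hgood : ∀ t ∈ Ico 0 τ, h t ∈ Ioo (-A) H ∧ w t < η := fun t ht => by
    by_contra hb
    exact (notMem_of_lt_csInf ht.2 hSbdd) ⟨⟨ht.1, ht.2.le.trans hτI.2⟩, fun hm => hb ⟨hm.1, hm.2⟩⟩
  have hw0η : w 0 < η := by
    refine lt_of_le_of_lt ?_ hw0'
    refine le_mul_of_one_le_right hw0 (Real.one_le_exp (mul_nonneg hL ?_))
    linarith [h0.1, h0.2]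
  have hτ0 : 0 < τ := by
    refine lt_of_le_of_ne hτI.1 fun h => hτbad ?_
    rw [← h]
    exact ⟨h0, hw0η⟩
  have hev : ∀ᶠ t in 𝓝[<] τ, h t ∈ Ioo (-A) H ∧ w t < η := by
    filter_upwards [Ico_mem_nhdsLT hτ0] with t ht using hgood t ht
  have hlimh : Tendsto h (𝓝[<] τ) (𝓝 (h τ)) :=
    (hh τ hτI).continuousAt.tendsto.mono_left nhdsWithin_le_nhds
  have hlimw : Tendsto w (𝓝[<] τ) (𝓝 (w τ)) :=
    (hw τ hτI).continuousAt.tendsto.mono_left nhdsWithin_le_nhds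
  have hτA : -A ≤ h τ := ge_of_tendsto hlimh (hev.mono fun t ht => ht.1.1.le)
  have hτH : h τ ≤ H := le_of_tendsto hlimh (hev.mono fun t ht => ht.1.2.le)
  have hτη : w τ ≤ η := le_of_tendsto hlimw (hev.mono fun t ht => ht.2.le)
  have hsub : Icc 0 τ ⊆ Icc 0 T := Icc_subset_Icc_right hτI.2
  refine hτbad ⟨⟨lt_of_le_of_ne hτA fun he => ?_, lt_of_le_of_ne hτH fun he => ?_⟩, ?_⟩
  · refine (hlow τ hτI he.symm hτη).not_ge (deriv_nonpos_of_forall_lt hτ0 (hh τ hτI) fun t ht => ?_)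
    exact he.symm.le.trans (hgood t ht).1.1.le
  · have := deriv_nonpos_of_forall_lt hτ0 (hh τ hτI).neg fun t ht =>
      neg_le_neg ((hgood t ht).1.2.le.trans he.ge)
    linarith [hupp τ hτI he hτη]
  -- Monotonicity gives w τ ≤ w 0 · exp (L (h 0 − h τ)), and h cannot drop by more than H + A.
  · have hanti : AntitoneOn (fun t => w t * Real.exp (L * h t)) (Icc 0 τ) := by
      have hd : ∀ t ∈ Icc 0 τ, HasDerivAt (fun t => w t * Real.exp (L * h t))
          (w' t * Real.exp (L * h t) + w t * (Real.exp (L * h t) * (L * h' t))) t := fun t ht =>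
        (hw t (hsub ht)).mul ((hh t (hsub ht)).const_mul L).exp
      refine antitoneOn_of_deriv_nonpos (convex_Icc 0 τ)
        (fun t ht => (hd t ht).continuousAt.continuousWithinAt)
        (fun t ht => (hd t (interior_subset ht)).differentiableAt.differentiableWithinAt)
        fun t ht => ?_
      rw [interior_Icc] at ht
      obtain ⟨hg1, hg2⟩ := hgood t ⟨ht.1.le, ht.2⟩
      have ht' : t ∈ Icc 0 τ := ⟨ht.1.le, ht.2.le⟩
      rw [(hd t ht').deriv]
      have := mul_nonpos_of_nonpos_of_nonneg (hlyap t (hsub ht') hg1.1.le hg1.2.le hg2.le)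
        (Real.exp_pos (L * h t)).le
      linarith
    have h1 : w τ * Real.exp (L * h τ) ≤ w 0 * Real.exp (L * h 0) :=
      hanti ⟨le_rfl, hτ0.le⟩ ⟨hτ0.le, le_rfl⟩ hτ0.le
    have h2 : w τ ≤ w 0 * Real.exp (L * (h 0 - h τ)) := by
      rw [mul_sub, Real.exp_sub, ← mul_div_assoc]
      exact (le_div_iff₀ (Real.exp_pos _)).mpr h1
    refine (h2.trans ?_).trans_lt hw0'
    have : h 0 - h τ ≤ H + A := by linarith [h0.2]
    gcongr

/-! ### Spread, first integral and their algebra -/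

/-- A measure of the distance of a point `(a, b)` of the phase space from the set where all `a j`
coincide and all `b j` coincide. -/
noncomputable def spread (K : ℝ) (p : (Fin m → ℝ) × (Fin m → ℝ)) : ℝ :=
  ∑ i, ∑ j, ((p.1 i - p.1 j) ^ 2 + K * (p.2 i - p.2 j - (p.1 i ^ 2 - p.1 j ^ 2) / 2) ^ 2)

/-- The scalar curvature, up to sign and as a function on the phase space: a first integral. -/
def scal (p : (Fin m → ℝ) × (Fin m → ℝ)) : ℝ :=
  2 * tr p.2 - tr (p.1 ^ 2) - tr p.1 ^ 2

theorem spread_nonneg {K : ℝ} (hK : 0 ≤ K) (p : (Fin m → ℝ) × (Fin m → ℝ)) : 0 ≤ spread K p :=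
  Finset.sum_nonneg fun i _ => Finset.sum_nonneg fun j _ => by positivity

theorem pair_le_spread {K : ℝ} (hK : 0 ≤ K) (p : (Fin m → ℝ) × (Fin m → ℝ)) (i j : Fin m) :
    (p.1 i - p.1 j) ^ 2 + K * (p.2 i - p.2 j - (p.1 i ^ 2 - p.1 j ^ 2) / 2) ^ 2 ≤ spread K p :=
  (Finset.single_le_sum (f := fun j => (p.1 i - p.1 j) ^ 2 +
      K * (p.2 i - p.2 j - (p.1 i ^ 2 - p.1 j ^ 2) / 2) ^ 2)
    (fun j _ => by positivity) (Finset.mem_univ j)).trans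
  (Finset.single_le_sum (f := fun i => ∑ j, ((p.1 i - p.1 j) ^ 2 +
      K * (p.2 i - p.2 j - (p.1 i ^ 2 - p.1 j ^ 2) / 2) ^ 2))
    (fun i _ => Finset.sum_nonneg fun j _ => by positivity) (Finset.mem_univ i))

/-- Lagrange's identity for a and the all-ones vector: the double sum is the Cauchy–Schwarz deficit.
It compares tr y² with h²/m up to the spread. -/
theorem tr_sq_eq (a : Fin m → ℝ) :
    2 * m * tr (a ^ 2) = 2 * tr a ^ 2 + ∑ i, ∑ j, (a i - a j) ^ 2 := by
  have : ∀ i j, (a i - a j) ^ 2 = a i ^ 2 + a j ^ 2 - 2 * (a i * a j) := fun i j => by ring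
  simp only [tr, this, Finset.sum_sub_distrib, Finset.sum_add_distrib, ← Finset.mul_sum,
    Finset.sum_const, Finset.card_univ, Fintype.card_fin, nsmul_eq_mul, Pi.pow_apply]
  rw [← Finset.sum_mul]
  ring

theorem tr_sq_lower (a : Fin m → ℝ) : tr a ^ 2 ≤ m * tr (a ^ 2) := by
  have : 0 ≤ ∑ i, ∑ j, (a i - a j) ^ 2 :=
    Finset.sum_nonneg fun i _ => Finset.sum_nonneg fun j _ => sq_nonneg _
  linarith [tr_sq_eq a]

theorem tr_sq_upper {K : ℝ} (hK : 0 ≤ K) (p : (Fin m → ℝ) × (Fin m → ℝ)) :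
    m * tr (p.1 ^ 2) ≤ tr p.1 ^ 2 + spread K p := by
  have h : ∑ i, ∑ j, (p.1 i - p.1 j) ^ 2 ≤ spread K p :=
    Finset.sum_le_sum fun i _ => Finset.sum_le_sum fun j _ =>
      le_add_of_nonneg_right (by positivity)
  linarith [tr_sq_eq p.1, spread_nonneg hK p]

theorem abs_sub_mean_le (a : Fin m → ℝ) {ε : ℝ} (h : ∀ i j, |a i - a j| ≤ ε) (i : Fin m) :
    |a i - tr a / m| ≤ ε := by
  have hm : (0 : ℝ) < m := Nat.cast_pos.mpr (Fin.pos i)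
  have h1 : a i - tr a / m = (∑ j, (a i - a j)) / m := by
    simp only [tr, Finset.sum_sub_distrib, Finset.sum_const, Finset.card_univ, Fintype.card_fin,
      nsmul_eq_mul]
    field_simp
  rw [h1, abs_div, abs_of_pos hm, div_le_iff₀ hm]
  refine (Finset.abs_sum_le_sum_abs _ _).trans ((Finset.sum_le_sum fun j _ => h i j).trans ?_)
  simp [mul_comm]

/-- The left side is the derivative of d² + k²f² when d' = σd + f and f' = hf + κd. Both diagonal
rates, σ and h, are at most h + A − A/M + ε. The cross term is at most 4|df| ≤ (2/k)(d² + k²f²),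
small for a large weight k. The condition on 2ε + 2/k spends half of the gain 2A/M. -/
theorem pair_growth_le {d f h σ κ k A M ε : ℝ} (hk : 0 < k) (hM : 1 ≤ M) (hA : 0 ≤ A)
    (hσ : σ ≤ h / M + ε) (hκ : |k ^ 2 * κ| ≤ 1) (hh : -A ≤ h) (hθ : 2 * ε + 2 / k ≤ A / M)
    (hε : 0 ≤ ε) :
    2 * d * (σ * d + f) + 2 * k ^ 2 * f * (h * f + κ * d)
      ≤ (2 * (h + A) - A / M) * (d ^ 2 + k ^ 2 * f ^ 2) := by
  have hAM : A / M ≤ A := div_le_self hA hM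
  have h1 : h / M ≤ h + A - A / M := by
    have : (h + A) / M ≤ h + A := div_le_self (by linarith) hM
    rw [add_div] at this
    linarith
  have hcross : 2 * (d * f) * (1 + k ^ 2 * κ) ≤ 2 / k * (d ^ 2 + k ^ 2 * f ^ 2) := by
    have e1 : 2 * (d * f) * (1 + k ^ 2 * κ) ≤ 4 * (|d| * |f|) := by
      refine (le_abs_self _).trans ?_
      rw [abs_mul, abs_mul, abs_mul, abs_two]
      have : |1 + k ^ 2 * κ| ≤ 2 := by
        have := abs_add_le 1 (k ^ 2 * κ)
        rw [abs_one] at this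
        linarith
      nlinarith [mul_nonneg (abs_nonneg d) (abs_nonneg f)]
    refine e1.trans ?_
    rw [div_mul_eq_mul_div, le_div_iff₀ hk]
    nlinarith [sq_nonneg (|d| - k * |f|), sq_abs d, sq_abs f]
  have hd : 2 * (σ * d ^ 2) ≤ 2 * ((h + A - A / M + ε) * d ^ 2) := by
    have := mul_le_mul_of_nonneg_right (hσ.trans (add_le_add_left h1 ε)) (sq_nonneg d)
    linarith
  have hf : 2 * (h * (k ^ 2 * f ^ 2)) ≤ 2 * ((h + A - A / M + ε) * (k ^ 2 * f ^ 2)) := by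
    have : h ≤ h + A - A / M + ε := by linarith
    have := mul_le_mul_of_nonneg_right this (by positivity : 0 ≤ k ^ 2 * f ^ 2)
    linarith
  have hlast := mul_le_mul_of_nonneg_right hθ (by positivity : 0 ≤ d ^ 2 + k ^ 2 * f ^ 2)
  linarith

/-! ### Evolution of trace, first integral and spread -/

section Dynamics

variable {I : Set ℝ} {y : ℝ → Fin m → ℝ}

theorem IsSolution.hasDerivAt_apply (h : IsSolution I y) {t : ℝ} (ht : t ∈ I) (j : Fin m) :
    HasDerivAt (fun t => y t j) (deriv y t j) t :=
  hasDerivAt_pi.mp (hasFDerivAt_fst.comp_hasDerivAt t (h.hasDerivAt ht) :) j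

theorem IsSolution.hasDerivAt_deriv_apply (h : IsSolution I y) {t : ℝ} (ht : t ∈ I) (j : Fin m) :
    HasDerivAt (fun t => deriv y t j) ((tr (y t) + y t j) * deriv y t j +
      (tr (y t ^ 2) * y t j - tr (y t) * y t j ^ 2)) t := by
  have := hasDerivAt_pi.mp (hasFDerivAt_snd.comp_hasDerivAt t (h.hasDerivAt ht) :) j
  simpa [field] using this

theorem IsSolution.hasDerivAt_tr (h : IsSolution I y) {t : ℝ} (ht : t ∈ I) :
    HasDerivAt (fun t => tr (y t)) (tr (deriv y t)) t :=
  HasDerivAt.fun_sum fun j _ => h.hasDerivAt_apply ht j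

/-- The trace of the right-hand side of (*) vanishes, so tr ÿ = tr y tr ẏ + tr(yẏ), which is the
derivative of (tr y² + (tr y)²)/2. -/
theorem IsSolution.scal_eq (h : IsSolution I y) {s t : ℝ} (hs : s ∈ I) (ht : t ∈ I) :
    scal (y t, deriv y t) = scal (y s, deriv y s) := by
  have hd : ∀ t ∈ I, HasDerivAt (fun t => scal (y t, deriv y t)) 0 t := fun t ht => by
    have h1 : HasDerivAt (fun t => tr (deriv y t)) _ t :=
      HasDerivAt.fun_sum fun j _ => h.hasDerivAt_deriv_apply ht j
    have h2 : HasDerivAt (fun t => tr (y t ^ 2)) _ t :=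
      HasDerivAt.fun_sum fun j _ => (h.hasDerivAt_apply ht j).fun_pow 2
    convert! ((h1.const_mul 2).sub h2).sub ((h.hasDerivAt_tr ht).fun_pow 2) using 1
    simp only [Finset.sum_add_distrib, Finset.sum_sub_distrib, add_mul, ← Finset.mul_sum, mul_assoc]
    simp only [tr, Pi.pow_apply, Nat.cast_ofNat, Nat.add_one_sub_one, pow_one]
    ring
  exact h.isOpen.is_const_of_deriv_eq_zero h.ordConnected.isPreconnected
    (fun t ht => (hd t ht).differentiableAt.differentiableWithinAt)
    (fun t ht => (hd t ht).deriv) ht hs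

/-- Subtracting (y_i² − y_j²)/2 from ẏ_i − ẏ_j removes y_iẏ_i − y_jẏ_j from the derivative, so each
pair obeys a linear system in (d, f). -/
theorem IsSolution.hasDerivAt_spread (h : IsSolution I y) (K : ℝ) {t : ℝ} (ht : t ∈ I) :
    HasDerivAt (fun t => spread K (y t, deriv y t))
      (∑ i, ∑ j, (2 * (y t i - y t j) * ((y t i + y t j) / 2 * (y t i - y t j) +
          (deriv y t i - deriv y t j - (y t i ^ 2 - y t j ^ 2) / 2)) +
        2 * K * (deriv y t i - deriv y t j - (y t i ^ 2 - y t j ^ 2) / 2) *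
          (tr (y t) * (deriv y t i - deriv y t j - (y t i ^ 2 - y t j ^ 2) / 2) +
            (tr (y t ^ 2) - tr (y t) * ((y t i + y t j) / 2)) * (y t i - y t j)))) t := by
  refine HasDerivAt.fun_sum fun i _ => HasDerivAt.fun_sum fun j _ => ?_
  have yi := h.hasDerivAt_apply ht i
  have yj := h.hasDerivAt_apply ht j
  have vi := h.hasDerivAt_deriv_apply ht i
  have vj := h.hasDerivAt_deriv_apply ht j
  convert! ((yi.fun_sub yj).fun_pow 2).fun_add ((((vi.fun_sub vj).fun_sub
    (((yi.fun_pow 2).fun_sub (yj.fun_pow 2)).div_const 2)).fun_pow 2).const_mul K) using 1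
  simp only [Nat.cast_ofNat, Nat.add_one_sub_one, pow_one]
  ring

/-- A solution starting close to the diagonal, with trace in `(-A, H)`, keeps both properties for all
positive times: `spread * exp (L * tr)` decreases along it. -/
theorem IsSolution.mem_trapping_region (h : IsSolution I y) (h0 : (0 : ℝ) ∈ I) (hm : 1 ≤ m)
    {A H L ε k β δ : ℝ} (hk : 0 < k) (hε : 0 < ε) (hε1 : ε ≤ 1) (hθ : 2 * ε + 2 / k ≤ A / m)
    (hκ : k ^ 2 * (m * ((A + 1) * ε)) ≤ 1) (hH : 0 ≤ H) (hHA : H ≤ A) (hA : 0 < A) (hβ : 0 < β)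
    (hL : L * β = 2) (hδ : L * δ ≤ A / m)
    (hlow : 0 < (m + 1) / (2 * m) * A ^ 2 + scal (y 0, deriv y 0) / 2)
    (hupp : ∀ x ∈ Icc (-A) H, (m + 1) / (2 * m) * x ^ 2 + scal (y 0, deriv y 0) / 2 + ε ^ 2 / 2
      ≤ -β * (x + A) + δ)
    (htr : tr (y 0) ∈ Ioo (-A) H)
    (hsp : spread (k ^ 2) (y 0, deriv y 0) * Real.exp (L * (H + A)) < ε ^ 2)
    {T : ℝ} (hT : T ∈ I) (hT0 : 0 ≤ T) :
    tr (y T) ∈ Ioo (-A) H ∧ spread (k ^ 2) (y T, deriv y T) < ε ^ 2 := by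
  have hM : (1 : ℝ) ≤ m := by exact_mod_cast hm
  have hM0 : (0 : ℝ) < m := by linarith
  have hL0 : 0 < L := by
    by_contra! hL'
    nlinarith
  have hsub : Icc 0 T ⊆ I := h.ordConnected.out h0 hT
  have hk2 : (0 : ℝ) ≤ k ^ 2 := sq_nonneg k
  have hpt : ∀ t ∈ Icc 0 T, tr (deriv y t) =
      (tr (y t ^ 2) + tr (y t) ^ 2 + scal (y 0, deriv y 0)) / 2 := fun t ht => by
    rw [← h.scal_eq h0 (hsub ht), scal]
    ring
  have hlo : ∀ t ∈ Icc 0 T, (m + 1) / (2 * m) * tr (y t) ^ 2 + scal (y 0, deriv y 0) / 2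
      ≤ tr (deriv y t) := fun t ht => by
    have h1 : tr (y t) ^ 2 / m ≤ tr (y t ^ 2) := by
      rw [div_le_iff₀' hM0]
      exact tr_sq_lower (y t)
    have h2 : ((m : ℝ) + 1) / (2 * m) * tr (y t) ^ 2 = (tr (y t) ^ 2 + tr (y t) ^ 2 / m) / 2 := by
      field_simp
    rw [hpt t ht, h2]
    linarith
  have hup : ∀ t ∈ Icc 0 T, tr (y t) ∈ Icc (-A) H →
      spread (k ^ 2) (y t, deriv y t) ≤ ε ^ 2 →
      tr (deriv y t) ≤ -β * (tr (y t) + A) + δ := fun t ht hx hw => by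
    have h1 : tr (y t ^ 2) ≤ tr (y t) ^ 2 / m + ε ^ 2 := by
      have h3 := tr_sq_upper hk2 (y t, deriv y t)
      have h4 : ε ^ 2 ≤ m * ε ^ 2 := le_mul_of_one_le_left (sq_nonneg ε) hM
      rw [← sub_le_iff_le_add, le_div_iff₀' hM0]
      simp only at h3
      linarith
    have h2 : ((m : ℝ) + 1) / (2 * m) * tr (y t) ^ 2 = (tr (y t) ^ 2 + tr (y t) ^ 2 / m) / 2 := by
      field_simp
    have h3 := hupp _ hx
    rw [h2] at h3
    rw [hpt t ht]
    linarith
  refine trapping_region hT0 hL0.le (fun t ht => h.hasDerivAt_tr (hsub ht))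
    (fun t ht => h.hasDerivAt_spread (k ^ 2) (hsub ht)) (fun t ht hxA hxH hw => ?_)
    (fun t ht hx hw => ?_) (fun t ht hx hw => ?_) htr (spread_nonneg hk2 _) hsp
  · have hpair : ∀ i j, |y t i - y t j| ≤ ε := fun i j => by
      refine abs_le_of_sq_le_sq ?_ hε.le
      have := pair_le_spread hk2 (y t, deriv y t) i j
      simp only at this
      have := mul_nonneg hk2
        (sq_nonneg (deriv y t i - deriv y t j - (y t i ^ 2 - y t j ^ 2) / 2))
      linarith
    have hmean := abs_sub_mean_le (y t) hpair
    have habs : |tr (y t)| ≤ A := abs_le.mpr ⟨hxA, hxH.trans hHA⟩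
    have habsj : ∀ j, |y t j| ≤ A + 1 := fun j => by
      have h1 : |tr (y t) / m| ≤ A := by
        rw [abs_div, abs_of_pos hM0]
        exact (div_le_self (abs_nonneg _) hM).trans habs
      have h2 := abs_add_le (y t j - tr (y t) / m) (tr (y t) / m)
      rw [sub_add_cancel] at h2
      linarith [hmean j]
    have hw' := spread_nonneg hk2 (y t, deriv y t)
    have hgrow : ∑ i, ∑ j, (2 * (y t i - y t j) * ((y t i + y t j) / 2 * (y t i - y t j) +
          (deriv y t i - deriv y t j - (y t i ^ 2 - y t j ^ 2) / 2)) +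
        2 * k ^ 2 * (deriv y t i - deriv y t j - (y t i ^ 2 - y t j ^ 2) / 2) *
          (tr (y t) * (deriv y t i - deriv y t j - (y t i ^ 2 - y t j ^ 2) / 2) +
            (tr (y t ^ 2) - tr (y t) * ((y t i + y t j) / 2)) * (y t i - y t j)))
        ≤ (2 * (tr (y t) + A) - A / m) * spread (k ^ 2) (y t, deriv y t) := by
      rw [spread, Finset.mul_sum]
      refine Finset.sum_le_sum fun i _ => ?_
      rw [Finset.mul_sum]
      refine Finset.sum_le_sum fun j _ => ?_
      refine pair_growth_le hk hM hA.le ?_ ?_ hxA hθ hε.le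
      · have := (abs_le.mp (hmean i)).2
        have := (abs_le.mp (hmean j)).2
        linarith
      -- In this form κ visibly vanishes on scalar matrices, hence is O(ε).
      · have h1 : tr (y t ^ 2) - tr (y t) * ((y t i + y t j) / 2)
            = ∑ l, y t l * (y t l - (y t i + y t j) / 2) := by
          simp only [tr, Pi.pow_apply, Finset.sum_mul, mul_sub, Finset.sum_sub_distrib, sq]
        rw [abs_mul, abs_of_nonneg hk2, h1]
        refine le_trans ?_ hκ
        gcongr
        refine (Finset.abs_sum_le_sum_abs _ _).trans
          ((Finset.sum_le_sum (g := fun _ => (A + 1) * ε) fun l _ => ?_).trans (by simp))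
        rw [abs_mul]
        have h2 : |y t l - (y t i + y t j) / 2| ≤ ε := by
          have h3 := abs_le.mp (hpair l i)
          have h4 := abs_le.mp (hpair l j)
          exact abs_le.mpr ⟨by linarith, by linarith⟩
        exact mul_le_mul (habsj l) h2 (abs_nonneg _) (by linarith)
    -- L h' ≤ −2(h + A) + Lδ cancels the growth 2(h + A), and Lδ is absorbed by −A/m.
    have h1 := mul_le_mul_of_nonneg_right
      (mul_le_mul_of_nonneg_left (hup t ht ⟨hxA, hxH⟩ hw) hL0.le) hw'
    have h2 : L * (-β * (tr (y t) + A) + δ) = -2 * (tr (y t) + A) + L * δ := by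
      linear_combination (-(tr (y t) + A)) * hL
    rw [h2] at h1
    have h3 := mul_le_mul_of_nonneg_right hδ hw'
    linarith
  · refine lt_of_lt_of_le ?_ (hlo t ht)
    rw [hx, neg_sq]
    exact hlow
  -- At the upper wall Lδ ≤ A/m ≤ A < 2(H + A) = Lβ(H + A), so h' < 0.
  · have h1 := hup t ht (by rw [hx]; exact ⟨by linarith, le_rfl⟩) hw
    rw [hx] at h1
    have h2 : A / m ≤ A := div_le_self hA.le hM
    have h3 : L * (β * (H + A)) = 2 * (H + A) := by linear_combination (H + A) * hL
    have h4 : L * δ < L * (β * (H + A)) := by linarith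
    linarith [lt_of_mul_lt_mul_left h4 hL0.le]

end Dynamics

/-- Mean plus pairwise differences control each entry: the mean of y comes from the trace, that of ẏ
from `scal`, the differences from the spread. -/
theorem norm_le_of_spread_le {A H k ε : ℝ} (hm : 1 ≤ m) (hk : 0 < k) (hε : 0 < ε) (hε1 : ε ≤ 1)
    (hHA : H ≤ A) {p : (Fin m → ℝ) × (Fin m → ℝ)} (htr : tr p.1 ∈ Ioo (-A) H)
    (hsp : spread (k ^ 2) p < ε ^ 2) :
    ‖p‖ ≤ (A + 1) + (m * (A + 1) ^ 2 + A ^ 2 + |scal p| + 1 / k + (A + 1) ^ 2) := by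
  have hM : (1 : ℝ) ≤ m := by exact_mod_cast hm
  have hM0 : (0 : ℝ) < m := by linarith
  have hk2 : (0 : ℝ) ≤ k ^ 2 := sq_nonneg k
  have hA : 0 ≤ A := by linarith [htr.1, htr.2]
  have hk' : 0 < 1 / k := by positivity
  have hps : ∀ i j, (p.1 i - p.1 j) ^ 2 +
      k ^ 2 * (p.2 i - p.2 j - (p.1 i ^ 2 - p.1 j ^ 2) / 2) ^ 2 ≤ 1 := fun i j => by
    have := pair_le_spread hk2 p i j
    nlinarith
  have hpair : ∀ i j, |p.1 i - p.1 j| ≤ 1 := fun i j => by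
    refine (sq_le_one_iff_abs_le_one _).mp ?_
    have := mul_nonneg hk2 (sq_nonneg (p.2 i - p.2 j - (p.1 i ^ 2 - p.1 j ^ 2) / 2))
    linarith [hps i j]
  have habs : |tr p.1| ≤ A := abs_le.mpr ⟨htr.1.le, htr.2.le.trans hHA⟩
  have habsj : ∀ j, |p.1 j| ≤ A + 1 := fun j => by
    have h1 : |tr p.1 / m| ≤ A := by
      rw [abs_div, abs_of_pos hM0]
      exact (div_le_self (abs_nonneg _) hM).trans habs
    have h2 := abs_add_le (p.1 j - tr p.1 / m) (tr p.1 / m)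
    rw [sub_add_cancel] at h2
    linarith [abs_sub_mean_le p.1 hpair j]
  have hsqj : ∀ j, p.1 j ^ 2 ≤ (A + 1) ^ 2 := fun j => sq_le_sq' (by linarith [abs_le.mp (habsj j)])
    (abs_le.mp (habsj j)).2
  have hpair2 : ∀ i j, |p.2 i - p.2 j| ≤ 1 / k + (A + 1) ^ 2 := fun i j => by
    have h1 : |p.2 i - p.2 j - (p.1 i ^ 2 - p.1 j ^ 2) / 2| ≤ 1 / k := by
      rw [le_div_iff₀ hk]
      refine le_of_eq_of_le (by rw [abs_mul, abs_of_pos hk])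
        (?_ : |(p.2 i - p.2 j - (p.1 i ^ 2 - p.1 j ^ 2) / 2) * k| ≤ 1)
      refine (sq_le_one_iff_abs_le_one _).mp ?_
      have := sq_nonneg (p.1 i - p.1 j)
      rw [mul_pow]
      linarith [hps i j]
    have h2 := abs_le.mp h1
    have h3 := hsqj i
    have h4 := hsqj j
    have h5 := sq_nonneg (p.1 i)
    have h6 := sq_nonneg (p.1 j)
    exact abs_le.mpr ⟨by linarith, by linarith⟩
  have hq : tr (p.1 ^ 2) ≤ m * (A + 1) ^ 2 :=
    (Finset.sum_le_sum fun j _ => hsqj j).trans (by simp)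
  have hq0 : 0 ≤ tr (p.1 ^ 2) := Finset.sum_nonneg fun j _ => sq_nonneg (p.1 j)
  have hh : tr p.1 ^ 2 ≤ A ^ 2 := sq_le_sq' (abs_le.mp habs).1 (abs_le.mp habs).2
  have htr2 : |tr p.2| ≤ m * (A + 1) ^ 2 + A ^ 2 + |scal p| := by
    have h1 : 2 * tr p.2 = tr (p.1 ^ 2) + tr p.1 ^ 2 + scal p := by
      rw [scal]
      ring
    have h2 := le_abs_self (scal p)
    have h3 := neg_abs_le (scal p)
    have h4 := sq_nonneg (tr p.1)
    have h5 := abs_nonneg (scal p)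
    exact abs_le.mpr ⟨by linarith, by linarith⟩
  have habs2 : ∀ j, |p.2 j| ≤ m * (A + 1) ^ 2 + A ^ 2 + |scal p| + 1 / k + (A + 1) ^ 2 :=
    fun j => by
      have h1 : |tr p.2 / m| ≤ |tr p.2| := by
        rw [abs_div, abs_of_pos hM0]
        exact div_le_self (abs_nonneg _) hM
      have h2 := abs_add_le (p.2 j - tr p.2 / m) (tr p.2 / m)
      rw [sub_add_cancel] at h2
      linarith [abs_sub_mean_le p.2 hpair2 j]
  rw [Prod.norm_def]
  refine max_le ((pi_norm_le_iff_of_nonneg (by positivity)).mpr fun j => ?_)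
    ((pi_norm_le_iff_of_nonneg (by positivity)).mpr fun j => ?_)
  · refine (habsj j).trans (le_add_of_nonneg_right (by positivity))
  · refine (habs2 j).trans (le_add_of_nonneg_left (by positivity))

theorem contDiff_scal {n : WithTop ℕ∞} : ContDiff ℝ n (scal (m := m)) :=
  ((contDiff_const.mul (contDiff_tr.comp contDiff_snd)).sub
    (contDiff_tr.comp (contDiff_fst.pow 2))).sub ((contDiff_tr.comp contDiff_fst).pow 2)

theorem continuous_spread (K : ℝ) : Continuous (spread (m := m) K) := by
  unfold spread
  fun_prop

/-- Solutions starting near `(ξ 1, -ζ 1)` are bounded in the future. -/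
theorem eventually_bounded_forward (hm : 1 ≤ m) (ξ ζ : ℝ) (hζ : 0 < ζ) :
    ∀ᶠ p : (Fin m → ℝ) × (Fin m → ℝ) in 𝓝 (ξ • (1 : Fin m → ℝ), -ζ • (1 : Fin m → ℝ)),
      ∀ (I : Set ℝ) (y : ℝ → Fin m → ℝ), IsSolution I y → 0 ∈ I → (y 0, deriv y 0) = p →
        ∃ R, ∀ t ∈ I, 0 ≤ t → ‖(y t, deriv y t)‖ ≤ R := by
  have hM : (1 : ℝ) ≤ m := by exact_mod_cast hm
  have hM0 : (0 : ℝ) < m := by linarith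
  set α : ℝ := (m + 1) / (2 * m) with hα
  have hα0 : 0 < α := by positivity
  set A₀ : ℝ := √(m ^ 2 * ξ ^ 2 + 2 * m ^ 2 * ζ / (m + 1)) with hA₀
  have hA₀sq : A₀ ^ 2 = m ^ 2 * ξ ^ 2 + 2 * m ^ 2 * ζ / (m + 1) := Real.sq_sqrt (by positivity)
  have hξA : m * |ξ| < A₀ := by
    refine Real.lt_sqrt_of_sq_lt ?_
    rw [mul_pow, sq_abs]
    have : 0 < 2 * (m : ℝ) ^ 2 * ζ / (m + 1) := by positivity
    linarith
  have hξ0 : 0 ≤ m * |ξ| := by positivity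
  have hA₀0 : 0 < A₀ := by linarith
  -- Keeping H strictly below A₀ makes β > 0; on [−A, H] it gives α(x² − A²) ≤ −β(x + A).
  obtain ⟨H, hξH, hHA₀⟩ := exists_between hξA
  set β : ℝ := α * (A₀ - H) with hβ
  have hβ0 : 0 < β := mul_pos hα0 (by linarith)
  -- Chosen so that Lδ = A₀/m.
  set δ : ℝ := β * A₀ / (2 * m) with hδ
  have hδ0 : 0 < δ := by positivity
  -- A exceeds A₀ just enough that the wall h = −A still repels when `scal` is perturbed by less
  -- than δ/2.
  set A : ℝ := √(A₀ ^ 2 + δ / (4 * α)) with hA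
  have hAsq : α * A ^ 2 = α * A₀ ^ 2 + δ / 4 := by
    rw [hA, Real.sq_sqrt (by positivity)]
    field_simp
  have hA₀A : A₀ ≤ A := Real.le_sqrt_of_sq_le (le_add_of_nonneg_right (by positivity))
  have hA0 : 0 < A := by linarith
  set L : ℝ := 2 / β with hL
  -- Then 2/k = A₀/(2m), and ε < A₀/(4m) makes 2ε fit into the other half of A₀/m.
  set k : ℝ := 4 * m / A₀ with hk
  have hk0 : 0 < k := by positivity
  obtain ⟨ε, hε0, hε⟩ : ∃ ε > 0, ε < min (min 1 (A₀ / (4 * m)))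
      (min (1 / (k ^ 2 * (m * (A + 1)))) (√(δ / 2))) := exists_between (by positivity)
  obtain ⟨⟨hε1, hε2⟩, hε3, hε4⟩ : (ε < 1 ∧ ε < A₀ / (4 * m)) ∧
      ε < 1 / (k ^ 2 * (m * (A + 1))) ∧ ε < √(δ / 2) := by simpa only [lt_min_iff] using hε
  have hεsq : ε ^ 2 < δ / 2 := (Real.lt_sqrt hε0.le).mp hε4
  have htr0 : tr (ξ • (1 : Fin m → ℝ)) = m * ξ := by simp [tr]
  have hscal0 : scal (ξ • (1 : Fin m → ℝ), -ζ • (1 : Fin m → ℝ)) = -2 * (α * A₀ ^ 2) := by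
    rw [hA₀sq, hα]
    simp only [scal, tr, Pi.smul_apply, Pi.pow_apply, Pi.one_apply, smul_eq_mul, mul_one,
      Finset.sum_const, Finset.card_univ, Fintype.card_fin, nsmul_eq_mul]
    field_simp
    ring
  have hspread0 : spread (k ^ 2) (ξ • (1 : Fin m → ℝ), -ζ • (1 : Fin m → ℝ)) = 0 := by
    simp [spread]
  have ev1 : ∀ᶠ p : (Fin m → ℝ) × (Fin m → ℝ) in
      𝓝 (ξ • (1 : Fin m → ℝ), -ζ • (1 : Fin m → ℝ)), tr p.1 ∈ Ioo (-A) H := by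
    refine ((contDiff_tr (n := 0)).continuous.comp continuous_fst).continuousAt.eventually_mem
      (isOpen_Ioo.mem_nhds ?_)
    have h1 : |m * ξ| < H := by rwa [abs_mul, abs_of_pos hM0]
    have h2 := abs_lt.mp h1
    simp only [Function.comp, htr0]
    exact ⟨by linarith, h2.2⟩
  have ev2 : ∀ᶠ p : (Fin m → ℝ) × (Fin m → ℝ) in
      𝓝 (ξ • (1 : Fin m → ℝ), -ζ • (1 : Fin m → ℝ)),
      scal p ∈ Ioo (-2 * (α * A₀ ^ 2) - δ / 2) (-2 * (α * A₀ ^ 2) + δ / 2) := by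
    refine (contDiff_scal (n := 0)).continuous.continuousAt.eventually_mem
      (isOpen_Ioo.mem_nhds ?_)
    rw [hscal0]
    exact ⟨by linarith, by linarith⟩
  have ev3 : ∀ᶠ p : (Fin m → ℝ) × (Fin m → ℝ) in
      𝓝 (ξ • (1 : Fin m → ℝ), -ζ • (1 : Fin m → ℝ)),
      spread (k ^ 2) p * Real.exp (L * (H + A)) ∈ Iio (ε ^ 2) := by
    refine ((continuous_spread (k ^ 2)).mul continuous_const).continuousAt.eventually_mem
      (isOpen_Iio.mem_nhds ?_)
    rw [Pi.mul_apply, hspread0, zero_mul]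
    exact pow_pos hε0 2
  filter_upwards [ev1, ev2, ev3] with p hp1 hp2 hp3 I y hy h0 hp
  subst hp
  refine ⟨(A + 1) + (m * (A + 1) ^ 2 + A ^ 2 + |scal (y 0, deriv y 0)| + 1 / k + (A + 1) ^ 2),
    fun t ht ht0 => ?_⟩
  have hLβ : L * β = 2 := div_mul_cancel₀ _ hβ0.ne'
  have hAm : A₀ / m ≤ A / m := by gcongr
  have hθ : 2 * ε + 2 / k ≤ A / m := by
    have e1 : 2 / k = A₀ / m / 2 := by
      rw [hk]
      field_simp
      norm_num
    have e2 : A₀ / (4 * m) = A₀ / m / 4 := by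
      field_simp
    linarith
  have hκ : k ^ 2 * (m * ((A + 1) * ε)) ≤ 1 := by
    have := ((lt_div_iff₀ (by positivity)).mp hε3).le
    linarith
  have hLδ : L * δ ≤ A / m := by
    have e1 : L * δ = A₀ / m := by
      rw [hδ, hL]
      field_simp
    linarith
  have hlow : 0 < α * A ^ 2 + scal (y 0, deriv y 0) / 2 := by
    have := hp2.1
    linarith
  have hupp : ∀ x ∈ Icc (-A) H, α * x ^ 2 + scal (y 0, deriv y 0) / 2 + ε ^ 2 / 2
      ≤ -β * (x + A) + δ := fun x hx => by
    have e1 : α * (x ^ 2 - A ^ 2) ≤ -β * (x + A) := by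
      have e2 : β ≤ α * (A - x) := by
        have := hx.2
        rw [hβ]
        gcongr
      have e3 := mul_le_mul_of_nonneg_right e2 (by linarith [hx.1] : 0 ≤ x + A)
      linarith
    have := hp2.2
    linarith
  obtain ⟨h1, h2⟩ := hy.mem_trapping_region h0 hm hk0 hε0 hε1.le hθ hκ (by linarith)
    (by linarith) hA0 hβ0 hLβ hLδ hlow hupp hp1 hp3 ht ht0
  rw [← hy.scal_eq h0 ht]
  exact norm_le_of_spread_le hm hk0 hε0 hε1.le (by linarith) h1 h2

end HarmonicCurvature


theorem theorem6p2 (m : ℕ) (hm : 3 ≤ m + 1) (ξ ζ : ℝ) (hζ : 0 < ζ) :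
    ∀ᶠ p : (Fin m → ℝ) × (Fin m → ℝ) in 𝓝 (ξ • (1 : Fin m → ℝ), -ζ • (1 : Fin m → ℝ)),
      ∀ (I : Set ℝ) (y : ℝ → Fin m → ℝ),
        HarmonicCurvature.IsMaximalSolution I y → 0 ∈ I → (y 0, deriv y 0) = p →
          I = univ ∧
          (∃ c : HarmonicCurvature.MetricCurve m, c.IsAssociated y) ∧
          ∀ c : HarmonicCurvature.MetricCurve m, c.IsAssociated y →
            HarmonicCurvature.IsCompleteMetric 𝓘(ℝ, Fin (m + 1) → ℝ) c.metric := by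
  -- Time reversal sends the initial data (p.1, p.2) to (−p.1, p.2), so the past is governed by the
  -- forward bound at −ξ with the same ζ.
  have hflip : Tendsto (fun p : (Fin m → ℝ) × (Fin m → ℝ) => (-p.1, p.2))
      (𝓝 (ξ • (1 : Fin m → ℝ), -ζ • (1 : Fin m → ℝ)))
      (𝓝 ((-ξ) • (1 : Fin m → ℝ), -ζ • (1 : Fin m → ℝ))) := by
    refine Continuous.tendsto' (by fun_prop) _ _ ?_
    simp
  filter_upwards [HarmonicCurvature.eventually_bounded_forward (by omega) ξ ζ hζ,
    hflip.eventually (HarmonicCurvature.eventually_bounded_forward (by omega) (-ξ) ζ hζ)]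
    with p hp hp' I y hy h0 hyp
  have hd := HarmonicCurvature.deriv_neg_comp_neg y
  obtain ⟨R, hR⟩ := hp I y hy.toIsSolution h0 hyp
  obtain ⟨R', hR'⟩ := hp' _ _ hy.toIsSolution.comp_neg (by simpa using h0) (by simp [hd, ← hyp])
  have hI : I = univ := by
    refine hy.eq_univ (R := max R R') h0 (fun t ht ht0 => (hR t ht ht0).trans (le_max_left _ _))
      fun t ht ht0 => le_trans ?_ (le_max_right _ _)
    have := hR' (-t) (by simpa using ht) (by linarith)
    simpa [hd, Prod.norm_def] using this
  subst hI
  exact ⟨rfl, HarmonicCurvature.MetricCurve.exists_isAssociated hy.toIsSolution.contDiff,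
    fun c _ => c.isCompleteMetric⟩
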